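/- Let $G$ be a finite simple triangle-free graph with $n\ge 3$ vertices and $m$ edges, and let $\lambda_1\ge\lambda_2\ge\cdots\ge\lambda_n$ be the eigenvalues, counted with multiplicity, of its adjacency matrix. Then $$\lambda_1^2+\lambda_2^2\le m,$$ with equality if and only if $G$ is a blow-up of at least one of the graphs $$P_2\cup K_1,\qquad 2P_2\cup K_1,\qquad P_4\cup K_1,\qquad P_5\cup K_1 .$$ Here $P_k$ is the path on $k$ vertices, $K_1$ is a single vertex, $\cup$ denotes disjoint union and $2P_2=P_2\cup P_2$. A blow-up of a graph $H$ is a graph (up to isomorphism) obtained by replacing each vertex $x$ of $H$ by an independent set $I_x$, possibly empty, and, for any two vertices $x,y$ of $H$, adding all edges between $I_x$ and $I_y$ if $xy$ is an edge of $H$ (and no other edges). -/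

import Mathlib

universe u v

/-- The adjacency eigenvalues `λ₁ ≥ λ₂ ≥ ⋯ ≥ λₙ` of a finite graph, with multiplicity, in
non-increasing order; the index starts at `0`, so `λ₁` has index `0` and `λ₂` has index `1`. -/
noncomputable def SimpleGraph.adjEigenvalues {V : Type u} [Fintype V] [DecidableEq V]
    (G : SimpleGraph V) [DecidableRel G.Adj] : Fin (Fintype.card V) → ℝ :=
  (G.isHermitian_adjMatrix (R := ℝ)).eigenvalues₀

/-- The graph obtained from `H` by replacing each vertex `x` by an independent set `I x`
(possibly empty), all edges being put between `I x` and `I y` when `x` and `y` are adjacent. -/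
def SimpleGraph.blowUp {W : Type v} (H : SimpleGraph W) (I : W → Type u) :
    SimpleGraph (Σ x, I x) where
  Adj p q := H.Adj p.1 q.1
  symm := ⟨fun _ _ h => H.symm.symm _ _ h⟩
  loopless := ⟨fun p h => H.loopless.irrefl p.1 h⟩

/-- `G` is (isomorphic to) a blow-up of `H`. -/
def SimpleGraph.IsBlowUpOf {V : Type u} {W : Type v} (G : SimpleGraph V) (H : SimpleGraph W) :
    Prop :=
  ∃ I : W → Type u, Nonempty (G ≃g H.blowUp I)

/-! The adjacency eigenvalues have power sums `0`, `2m`, `0` for exponents 1, 2, 3; the last is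
triangle-freeness. Put `a = λ₁`, `b = λ₂` and suppose `a² + b² ≥ m`. The absolute values of the
negative eigenvalues are at most `a` (Perron–Frobenius), their squares sum to at most `a² + b²`, and
their cubes to at least `a³ + b³`. By the equality case of Karamata for `t ↦ t^(3/2)`
(`card_support_le_two_of_sum_sq_le`), at most two are nonzero and `a² + b² = m`. This gives the
inequality, and equality forces rank at most 4; Newton-type identities give the converse.

It remains to classify triangle-free graphs of rank at most 4. An induced `2P₂` or `P₄` has a
nonsingular 4×4 adjacency matrix, so it determines all of `G` (`eq_mul_mul_of_rank_le`); with
neither, `G` is complete bipartite plus isolated vertices. -/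

/-! ### Inequalities between sums of squares and sums of cubes -/

/-- Chord bound for the convex function `t ↦ t^(3/2)` on `[b², a²]`: the cubic in `key` has no
linear term and says `(a+b)y³ ≤ (a²+ab+b²)y² - a²b²`. Add it at `x` and `c`. -/
theorem cube_add_cube_le_of_sq_add_sq_eq {a b x c : ℝ} (hb : 0 ≤ b) (hbx : b ≤ x) (hxa : x ≤ a)
    (hc : 0 ≤ c) (h : x ^ 2 + c ^ 2 = a ^ 2 + b ^ 2) : x ^ 3 + c ^ 3 ≤ a ^ 3 + b ^ 3 := by
  have ha : 0 ≤ a := by linarith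
  have hbc : b ≤ c := by
    apply (sq_le_sq₀ hb hc).1
    nlinarith
  have hca : c ≤ a := by
    apply (sq_le_sq₀ hc ha).1
    nlinarith
  rcases (add_nonneg ha hb).eq_or_lt with h0 | h0
  · have h1 : a = 0 := by linarith
    have h2 : b = 0 := by linarith
    have h3 : x = 0 := by linarith
    have h4 : c = 0 := by linarith
    simp [h1, h2, h3, h4]
  · have key : ∀ y : ℝ, b ≤ y → y ≤ a → (y - a) * (y - b) * ((a + b) * y + a * b) ≤ 0 := by
      intro y h1 h2
      have : 0 ≤ (a + b) * y + a * b :=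
        add_nonneg (mul_nonneg h0.le (hb.trans h1)) (mul_nonneg ha hb)
      exact mul_nonpos_of_nonpos_of_nonneg
        (mul_nonpos_of_nonpos_of_nonneg (by linarith) (by linarith)) this
    have h1 := key x hbx hxa
    have h2 := key c hbc hca
    have h3 : (a + b) * (x ^ 3 + c ^ 3) ≤ (a + b) * (a ^ 3 + b ^ 3) := by
      have e : (a ^ 2 + a * b + b ^ 2) * (x ^ 2 + c ^ 2) =
        (a ^ 2 + a * b + b ^ 2) * (a ^ 2 + b ^ 2) := by rw [h]
      linear_combination h1 + h2 + e
    exact le_of_mul_le_mul_left h3 h0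

/-- If `0 ≤ y i ≤ c` and `∑ y i ^ 2 ≤ k * c ^ 2` while `∑ y i ^ 3 ≥ k * c ^ 3`, then
every `y i` is `0` or `c`, exactly `k` of them (if `c > 0`) being nonzero. -/
theorem card_support_of_sum_sq_le_of_le_sum_cube {ι : Type*} (s : Finset ι) (y : ι → ℝ) {c : ℝ}
    (k : ℕ) (hc : 0 ≤ c) (hyc : ∀ i ∈ s, y i ≤ c)
    (h2 : ∑ i ∈ s, y i ^ 2 ≤ k * c ^ 2) (h3 : k * c ^ 3 ≤ ∑ i ∈ s, y i ^ 3) :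
    ∑ i ∈ s, y i ^ 2 = k * c ^ 2 ∧ (s.filter fun i => y i ≠ 0).card ≤ k := by
  -- These nonnegative terms sum to at most `0`, so each vanishes.
  have hle : ∀ i ∈ s, 0 ≤ y i ^ 2 * (c - y i) := fun i hi =>
    mul_nonneg (sq_nonneg _) (sub_nonneg.2 (hyc i hi))
  have hsum : ∑ i ∈ s, y i ^ 2 * (c - y i) = c * ∑ i ∈ s, y i ^ 2 - ∑ i ∈ s, y i ^ 3 := by
    rw [Finset.mul_sum, ← Finset.sum_sub_distrib]
    exact Finset.sum_congr rfl fun i _ => by ring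
  have hnn := Finset.sum_nonneg hle
  have hmul : c * ∑ i ∈ s, y i ^ 2 ≤ c * (k * c ^ 2) := mul_le_mul_of_nonneg_left h2 hc
  have hzero : ∑ i ∈ s, y i ^ 2 * (c - y i) = 0 := by
    apply le_antisymm _ hnn
    rw [hsum]
    linear_combination hmul + h3
  rw [Finset.sum_eq_zero_iff_of_nonneg hle] at hzero
  have hval : ∀ i ∈ s, y i ≠ 0 → y i = c := by
    intro i hi h0
    rcases mul_eq_zero.1 (hzero i hi) with h | h
    · exact absurd (pow_eq_zero_iff two_ne_zero |>.1 h) h0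
    · linarith
  rcases hc.eq_or_lt with rfl | hc
  · have hv : ∀ i ∈ s, y i = 0 := fun i hi => by
      by_contra h0
      exact h0 (hval i hi h0)
    constructor
    · rw [Finset.sum_eq_zero fun i hi => by rw [hv i hi]; ring]
      ring
    · rw [Finset.filter_false_of_mem (fun i hi => not_not.2 (hv i hi))]
      simp
  · have hcard : ∑ i ∈ s, y i ^ 2 = (s.filter fun i => y i ≠ 0).card * c ^ 2 := by
      rw [← Finset.sum_filter_add_sum_filter_not s (fun i => y i ≠ 0)]
      rw [Finset.sum_congr rfl (g := fun _ => c ^ 2) fun i hi => by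
        rw [hval i (Finset.mem_filter.1 hi).1 (Finset.mem_filter.1 hi).2]]
      rw [Finset.sum_eq_zero (s := s.filter fun i => ¬ y i ≠ 0) fun i hi => by
        rw [not_not.1 (Finset.mem_filter.1 hi).2]; ring]
      simp
    constructor
    · apply le_antisymm h2
      have h : c * (k * c ^ 2) ≤ c * ∑ i ∈ s, y i ^ 2 := by
        linear_combination h3 + hnn + hsum
      exact le_of_mul_le_mul_left h hc
    · rw [hcard] at h2
      exact_mod_cast le_of_mul_le_mul_right h2 (by positivity)

/-- The equality case of Karamata's inequality for `t ↦ t ^ (3 / 2)` against a two-point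
family. -/
theorem card_support_le_two_of_sum_sq_le {ι : Type*} (s : Finset ι) (y : ι → ℝ) {a b : ℝ}
    (hb : 0 ≤ b) (hba : b ≤ a) (hy0 : ∀ i ∈ s, 0 ≤ y i) (hya : ∀ i ∈ s, y i ≤ a)
    (h2 : ∑ i ∈ s, y i ^ 2 ≤ a ^ 2 + b ^ 2) (h3 : a ^ 3 + b ^ 3 ≤ ∑ i ∈ s, y i ^ 3) :
    ∑ i ∈ s, y i ^ 2 = a ^ 2 + b ^ 2 ∧ (s.filter fun i => y i ≠ 0).card ≤ 2 := by
  classical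
  have ha : 0 ≤ a := hb.trans hba
  by_cases hle : ∀ i ∈ s, y i ≤ b
  · have h : ∑ i ∈ s, y i ^ 3 ≤ b * ∑ i ∈ s, y i ^ 2 := by
      rw [Finset.mul_sum]
      refine Finset.sum_le_sum fun i hi => ?_
      have := mul_le_mul_of_nonneg_right (hle i hi) (sq_nonneg (y i))
      linear_combination this
    have h' := mul_le_mul_of_nonneg_left h2 hb
    have hab : a = b := by
      by_contra hne
      have hlt : b < a := lt_of_le_of_ne hba (Ne.symm hne)
      have : 0 < (a - b) * a ^ 2 := mul_pos (by linarith) (by nlinarith)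
      linarith
    subst hab
    have := card_support_of_sum_sq_le_of_le_sum_cube s y 2 hb hle
      (by push_cast; linarith) (by push_cast; linarith)
    refine ⟨by rw [this.1]; push_cast; ring, this.2⟩
  · push Not at hle
    obtain ⟨j, hj, hbj⟩ := hle
    have e2 := Finset.add_sum_erase s (fun i => y i ^ 2) hj
    have e3 := Finset.add_sum_erase s (fun i => y i ^ 3) hj
    -- Split off one entry above `b`: `c` completes `y j` to a pair with the same sum of squares as
    -- `(a, b)`, and the other entries fall under the one-point case.
    obtain ⟨c, hc, hcc⟩ : ∃ c : ℝ, 0 ≤ c ∧ c ^ 2 = a ^ 2 + b ^ 2 - y j ^ 2 := by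
      refine ⟨√(a ^ 2 + b ^ 2 - y j ^ 2), Real.sqrt_nonneg _, Real.sq_sqrt ?_⟩
      have := pow_le_pow_left₀ (hy0 j hj) (hya j hj) 2
      nlinarith
    have hcube := cube_add_cube_le_of_sq_add_sq_eq hb hbj.le (hya j hj) hc (by linarith)
    have hyc : ∀ i ∈ s.erase j, y i ≤ c := by
      intro i hi
      apply (sq_le_sq₀ (hy0 i (Finset.mem_of_mem_erase hi)) hc).1
      have := Finset.single_le_sum (f := fun i => y i ^ 2) (fun i _ => sq_nonneg (y i)) hi
      linarith
    have := card_support_of_sum_sq_le_of_le_sum_cube (s.erase j) y 1 hc hyc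
      (by push_cast; linarith) (by push_cast; linarith)
    refine ⟨by rw [← e2, this.1]; push_cast; linarith, ?_⟩
    rw [Finset.filter_erase] at this
    have h := Finset.pred_card_le_card_erase (s := s.filter fun i => y i ≠ 0) (a := j)
    omega

/-- If `∑ x i = ∑ x i ^ 3 = 0` and at most one `x i` is positive, then at most one is negative. -/
theorem card_neg_le_one_of_card_pos_le_one {ι : Type*} [Fintype ι] (x : ι → ℝ)
    (h1 : ∑ i, x i = 0) (h3 : ∑ i, x i ^ 3 = 0)
    (hp : (Finset.univ.filter fun i => 0 < x i).card ≤ 1) :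
    (Finset.univ.filter fun i => x i < 0).card ≤ 1 := by
  classical
  by_cases hex : ∃ j, 0 < x j
  · obtain ⟨j, hj⟩ := hex
    have hnp : ∀ i, i ≠ j → x i ≤ 0 := by
      intro i hij
      by_contra hi
      exact hij (Finset.card_le_one.1 hp i (by simpa using hi) j (by simpa using hj))
    set s := Finset.univ.erase j
    have e1 := Finset.add_sum_erase Finset.univ x (Finset.mem_univ j)
    have e3 := Finset.add_sum_erase Finset.univ (fun i => x i ^ 3) (Finset.mem_univ j)
    have hs1 : ∑ i ∈ s, -x i = x j := by rw [Finset.sum_neg_distrib]; linarith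
    have hle : ∀ i ∈ s, -x i ≤ x j := by
      intro i hi
      rw [← hs1]
      exact Finset.single_le_sum (f := fun i => -x i)
        (fun i hi => neg_nonneg.2 (hnp i (Finset.ne_of_mem_erase hi))) hi
    have hs3 : ∑ i ∈ s, (-x i) ^ 3 = x j ^ 3 := by
      rw [Finset.sum_congr rfl (g := fun i => -(x i ^ 3)) fun i _ => by ring,
        Finset.sum_neg_distrib]
      linarith
    -- The numbers `-x i` are nonnegative with sum `x j`, so each is at most `x j`.
    have hs2 : ∑ i ∈ s, (-x i) ^ 2 ≤ x j ^ 2 := by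
      calc ∑ i ∈ s, (-x i) ^ 2 ≤ ∑ i ∈ s, x j * (-x i) := by
            refine Finset.sum_le_sum fun i hi => ?_
            have := mul_le_mul_of_nonneg_right (hle i hi)
              (neg_nonneg.2 (hnp i (Finset.ne_of_mem_erase hi)))
            linear_combination this
        _ = x j ^ 2 := by rw [← Finset.mul_sum, hs1]; ring
    have := (card_support_of_sum_sq_le_of_le_sum_cube s (fun i => -x i) 1 hj.le hle
      (by push_cast; linarith) (by push_cast; linarith)).2
    refine (Finset.card_le_card fun i hi => ?_).trans this
    have hi : x i < 0 := by simpa using hi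
    have : i ≠ j := by rintro rfl; linarith
    simp [s, this, hi.ne]
  · push Not at hex
    have := (Finset.sum_eq_zero_iff_of_nonpos fun i _ => hex i).1 h1
    simp [fun i => this i (Finset.mem_univ i)]

/-! ### Sequences with vanishing first and third power sums -/

section PowerSums

variable {n : ℕ} (hn : 3 ≤ n) {x : Fin n → ℝ}

/-- Otherwise entries 1 and 2 are both negative while only entry 0 can be positive. This needs `3 ≤
n`: the sequence `1, -1` is a counterexample for `n = 2`. -/
theorem second_nonneg_of_sum_eq_zero (hx : Antitone x) (h1 : ∑ i, x i = 0)
    (h3 : ∑ i, x i ^ 3 = 0) : 0 ≤ x ⟨1, by omega⟩ := by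
  by_contra! hlt
  have hneg : ∀ i : Fin n, 1 ≤ (i : ℕ) → x i < 0 := fun i hi =>
    (hx (show (⟨1, by omega⟩ : Fin n) ≤ i from hi)).trans_lt hlt
  have hz : ∀ i : Fin n, 0 < x i → (i : ℕ) = 0 := by
    intro i hi
    by_contra h
    have := hneg i (by omega)
    linarith
  have := card_neg_le_one_of_card_pos_le_one x h1 h3 (Finset.card_le_one.2 fun i hi j hj => by
    ext
    rw [hz i (by simpa using hi), hz j (by simpa using hj)])
  have := Finset.card_le_one.1 this ⟨1, by omega⟩ (by simpa using hlt) ⟨2, by omega⟩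
    (by simpa using hneg ⟨2, by omega⟩ (by simp))
  simp at this

theorem sum_sq_eq_and_card_support_le_four (hx : Antitone x)
    (hmax : ∀ i, |x i| ≤ x ⟨0, by omega⟩) {m : ℝ} (h1 : ∑ i, x i = 0)
    (h2 : ∑ i, x i ^ 2 = 2 * m) (h3 : ∑ i, x i ^ 3 = 0)
    (hm : m ≤ x ⟨0, by omega⟩ ^ 2 + x ⟨1, by omega⟩ ^ 2) :
    x ⟨0, by omega⟩ ^ 2 + x ⟨1, by omega⟩ ^ 2 = m ∧
      (Finset.univ.filter fun i => x i ≠ 0).card ≤ 4 := by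
  have hb := second_nonneg_of_sum_eq_zero hn hx h1 h3
  set i0 : Fin n := ⟨0, by omega⟩ with hi0
  set i1 : Fin n := ⟨1, by omega⟩ with hi1
  have hba : x i1 ≤ x i0 := hx (show (0 : ℕ) ≤ 1 by simp)
  have hne : i0 ≠ i1 := by simp [hi0, hi1]
  set N := Finset.univ.filter fun i => x i < 0 with hN
  set P := Finset.univ.filter fun i => ¬ x i < 0 with hP
  have hsub : ({i0, i1} : Finset (Fin n)) ⊆ P := by
    intro i hi
    rcases Finset.mem_insert.1 hi with rfl | hi
    · simpa [hP] using hb.trans hba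
    · rw [Finset.mem_singleton.1 hi]
      simpa [hP] using hb
  have d2 := Finset.sum_filter_add_sum_filter_not Finset.univ (fun i => x i < 0) fun i => x i ^ 2
  have d3 := Finset.sum_filter_add_sum_filter_not Finset.univ (fun i => x i < 0) fun i => x i ^ 3
  rw [← hN, ← hP] at d2 d3
  have p2 : x i0 ^ 2 + x i1 ^ 2 ≤ ∑ i ∈ P, x i ^ 2 := by
    rw [← Finset.sum_pair (f := fun i => x i ^ 2) hne]
    exact Finset.sum_le_sum_of_subset_of_nonneg hsub fun i _ _ => sq_nonneg _
  have p3 : x i0 ^ 3 + x i1 ^ 3 ≤ ∑ i ∈ P, x i ^ 3 := by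
    rw [← Finset.sum_pair (f := fun i => x i ^ 3) hne]
    refine Finset.sum_le_sum_of_subset_of_nonneg hsub fun i hi _ => ?_
    have : 0 ≤ x i := by simpa [hP] using hi
    positivity
  have s3 : ∑ i ∈ N, (-x i) ^ 3 = -∑ i ∈ N, x i ^ 3 := by
    rw [← Finset.sum_neg_distrib]
    exact Finset.sum_congr rfl fun i _ => by ring
  have s2 : ∑ i ∈ N, (-x i) ^ 2 = ∑ i ∈ N, x i ^ 2 := by simp
  obtain ⟨hs, hcard⟩ := card_support_le_two_of_sum_sq_le N (fun i => -x i) hb hba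
    (fun i hi => by
      have : x i < 0 := by simpa [hN] using hi
      linarith)
    (fun i _ => (neg_le_abs _).trans (hmax i)) (by linarith) (by linarith)
  rw [s2] at hs
  have hm' : x i0 ^ 2 + x i1 ^ 2 = m := by linarith
  refine ⟨hm', ?_⟩
  -- The negative part already uses half of `2m`, so the top two entries exhaust the rest.
  have hPsum : ∑ i ∈ P \ {i0, i1}, x i ^ 2 = 0 := by
    have := Finset.sum_sdiff (f := fun i => x i ^ 2) hsub
    rw [Finset.sum_pair hne] at this
    linarith
  rw [Finset.sum_eq_zero_iff_of_nonneg fun i _ => sq_nonneg _] at hPsum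
  have hss : (Finset.univ.filter fun i => x i ≠ 0) ⊆
      (N.filter fun i => -x i ≠ 0) ∪ {i0, i1} := by
    intro i hi
    have hi : x i ≠ 0 := by simpa using hi
    by_cases h : i ∈ ({i0, i1} : Finset (Fin n))
    · exact Finset.mem_union_right _ h
    · refine Finset.mem_union_left _ ?_
      by_cases h' : x i < 0
      · simp [hN, h', hi]
      · exact absurd (pow_eq_zero_iff two_ne_zero |>.1
          (hPsum i (Finset.mem_sdiff.2 ⟨by simpa [hP] using h', h⟩))) hi
  have := (Finset.card_le_card hss).trans (Finset.card_union_le _ _)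
  have h2 : ({i0, i1} : Finset (Fin n)).card ≤ 2 := Finset.card_le_two
  omega

/-- With at most four nonzero entries, three of one sign would leave at most one of the other, which
`card_neg_le_one_of_card_pos_le_one` forbids. So two entries of each sign suffice, padding with
zeros. -/
theorem sum_sq_eq_of_card_support_le_four (hx : Antitone x) {m : ℝ} (h1 : ∑ i, x i = 0)
    (h2 : ∑ i, x i ^ 2 = 2 * m) (h3 : ∑ i, x i ^ 3 = 0)
    (hc : (Finset.univ.filter fun i => x i ≠ 0).card ≤ 4) :
    x ⟨0, by omega⟩ ^ 2 + x ⟨1, by omega⟩ ^ 2 = m := by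
  have hb := second_nonneg_of_sum_eq_zero hn hx h1 h3
  set i0 : Fin n := ⟨0, by omega⟩ with hi0
  set i1 : Fin n := ⟨1, by omega⟩ with hi1
  have hba : x i1 ≤ x i0 := hx (show (0 : ℕ) ≤ 1 by simp)
  have hne : i0 ≠ i1 := by simp [hi0, hi1]
  have hcard : (Finset.univ.filter fun i => x i < 0).card +
      (Finset.univ.filter fun i => 0 < x i).card ≤ 4 := by
    rw [← Finset.card_union_of_disjoint]
    · refine (Finset.card_le_card fun i hi => ?_).trans hc
      simp only [Finset.mem_union, Finset.mem_filter, Finset.mem_univ, true_and] at hi ⊢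
      exact hi.elim ne_of_lt ne_of_gt
    · exact Finset.disjoint_filter.2 fun i _ h => not_lt.2 h.le
  have hpn := card_neg_le_one_of_card_pos_le_one x h1 h3
  have hnp := card_neg_le_one_of_card_pos_le_one (fun i => -x i) (by simp [h1])
    (by simp [Odd.neg_pow (show Odd 3 by decide), h3])
  simp only [neg_pos, neg_lt_zero] at hnp
  set N := Finset.univ.filter fun i => x i < 0 with hN
  have hnonpos : ∀ i, i ≠ i0 → i ≠ i1 → x i ≤ 0 := by
    intro i hi hi'
    by_contra! hpos
    have h2i : 2 ≤ (i : ℕ) := by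
      by_contra h
      have h : (i : ℕ) = 0 ∨ (i : ℕ) = 1 := by omega
      rcases h with h | h
      · exact hi (Fin.ext h)
      · exact hi' (Fin.ext h)
    have h1' : x i ≤ x i1 := hx (show (1 : ℕ) ≤ i by omega)
    have : ({i, i0, i1} : Finset (Fin n)) ⊆ Finset.univ.filter fun i => 0 < x i := by
      intro j hj
      simp only [Finset.mem_insert, Finset.mem_singleton] at hj
      simp only [Finset.mem_filter, Finset.mem_univ, true_and]
      rcases hj with rfl | rfl | rfl <;> linarith
    have h3' := Finset.card_le_card this
    rw [Finset.card_eq_three.2 ⟨i, i0, i1, hi, hi', hne, rfl⟩] at h3'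
    omega
  have hN2 : N.card ≤ 2 := by omega
  have hsum : ∀ k : ℕ, k ≠ 0 → ∑ i, x i ^ k = ∑ i ∈ N, x i ^ k + (x i0 ^ k + x i1 ^ k) := by
    intro k hk
    rw [← Finset.sum_filter_add_sum_filter_not Finset.univ (fun i => x i < 0),
      ← Finset.sum_pair (f := fun i => x i ^ k) hne]
    congr 1
    symm
    refine Finset.sum_subset (fun i hi => ?_) fun i hi hi' => ?_
    · simp only [Finset.mem_insert, Finset.mem_singleton] at hi
      simp only [Finset.mem_filter, Finset.mem_univ, true_and, not_lt]
      rcases hi with rfl | rfl <;> linarith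
    · simp only [Finset.mem_insert, Finset.mem_singleton, not_or] at hi'
      have h : 0 ≤ x i := by simpa using hi
      rw [le_antisymm (hnonpos i hi'.1 hi'.2) h, zero_pow hk]
  obtain ⟨y, z, hy, hz, hyz⟩ : ∃ y z : ℝ, y ≤ 0 ∧ z ≤ 0 ∧
      ∀ k : ℕ, k ≠ 0 → ∑ i ∈ N, x i ^ k = y ^ k + z ^ k := by
    have hneg : ∀ i ∈ N, x i ≤ 0 := fun i hi => (by simpa [hN] using hi : x i < 0).le
    obtain h | h | h : N.card = 0 ∨ N.card = 1 ∨ N.card = 2 := by omega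
    · refine ⟨0, 0, le_rfl, le_rfl, fun k hk => ?_⟩
      rw [Finset.card_eq_zero.1 h]
      simp [hk]
    · obtain ⟨i, hi⟩ := Finset.card_eq_one.1 h
      refine ⟨x i, 0, hneg i (by simp [hi]), le_rfl, fun k hk => ?_⟩
      simp [hi, hk]
    · obtain ⟨i, j, hij, hi⟩ := Finset.card_eq_two.1 h
      exact ⟨x i, x j, hneg i (by simp [hi]), hneg j (by simp [hi]), fun k _ => by
        rw [hi, Finset.sum_pair hij]⟩
  have e1 := hsum 1 one_ne_zero
  have e2 := hsum 2 two_ne_zero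
  have e3 := hsum 3 three_ne_zero
  rw [hyz _ (by simp)] at e1 e2 e3
  simp only [pow_one] at e1
  rw [h1] at e1
  rw [h2] at e2
  rw [h3] at e3
  generalize x i0 = a at *
  generalize x i1 = b at *
  -- When `a + b + y + z = 0`, the sum of cubes is `3(a+b)(yz - ab)`.
  have hprod : (a + b) * (a * b - y * z) = 0 := by
    have hyz' : z = -(a + b) - y := by linarith
    subst hyz'
    linear_combination (1 / 3) * e3
  rcases mul_eq_zero.1 hprod with h | h
  · have ha' : a = 0 := by linarith
    have hb' : b = 0 := by linarith
    have hy' : y = 0 := by linarith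
    have hz' : z = 0 := by linarith
    subst ha' hb' hy' hz'
    linarith
  · have hyz' : z = -(a + b) - y := by linarith
    subst hyz'
    linear_combination (-1 / 2) * e2 - h

end PowerSums

/-! ### Spectra and ranks of real matrices -/

namespace Matrix

variable {ι : Type*} [Fintype ι] [DecidableEq ι]

open Unitary in
theorem IsHermitian.trace_pow_eq_sum_eigenvalues₀ {A : Matrix ι ι ℝ} (hA : A.IsHermitian) (k : ℕ) :
    (A ^ k).trace = ∑ i, hA.eigenvalues₀ i ^ k := by
  have h : A ^ k = conjStarAlgAut ℝ _ hA.eigenvectorUnitary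
      (diagonal fun i => hA.eigenvalues i ^ k) := by
    conv_lhs => rw [hA.spectral_theorem, ← map_pow, diagonal_pow]
    rfl
  rw [h, conjStarAlgAut_apply, trace_mul_comm, ← mul_assoc]
  simp only [coe_star_mul_self, one_mul, trace_diagonal]
  exact Equiv.sum_comp (Fintype.equivOfCardEq (Fintype.card_fin _)).symm
    fun i => hA.eigenvalues₀ i ^ k

theorem IsHermitian.rank_eq_card_support_eigenvalues₀ {A : Matrix ι ι ℝ} (hA : A.IsHermitian) :
    A.rank = (Finset.univ.filter fun i => hA.eigenvalues₀ i ≠ 0).card := by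
  rw [hA.rank_eq_card_non_zero_eigs, ← Fintype.card_subtype]
  exact Fintype.card_congr
    ((Fintype.equivOfCardEq (Fintype.card_fin _)).symm.subtypeEquiv fun _ => Iff.rfl)

open Unitary in
theorem IsHermitian.dotProduct_mulVec_le {A : Matrix ι ι ℝ} (hA : A.IsHermitian) {c : ℝ}
    (hc : ∀ i, hA.eigenvalues i ≤ c) (v : ι → ℝ) : v ⬝ᵥ (A *ᵥ v) ≤ c * (v ⬝ᵥ v) := by
  have h : c • (1 : Matrix ι ι ℝ) - A = conjStarAlgAut ℝ _ hA.eigenvectorUnitary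
      (diagonal fun i => c - hA.eigenvalues i) := by
    conv_lhs => rw [hA.spectral_theorem]
    rw [← map_one (conjStarAlgAut ℝ _ hA.eigenvectorUnitary), ← map_smul, ← map_sub]
    congr 1
    ext i j
    by_cases hij : i = j
    · subst hij
      simp
    · simp [hij]
  have hp : (c • (1 : Matrix ι ι ℝ) - A).PosSemidef := by
    rw [h, conjStarAlgAut_apply]
    exact (PosSemidef.diagonal fun i => sub_nonneg.2 (hc i)).mul_mul_conjTranspose_same _
  have := hp.dotProduct_mulVec_nonneg v
  simp only [sub_mulVec, smul_mulVec, one_mulVec, dotProduct_sub, dotProduct_smul, star_trivial,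
    smul_eq_mul] at this
  linarith

/-- The weak Perron–Frobenius bound for symmetric matrices. -/
theorem IsHermitian.abs_eigenvalues_le {A : Matrix ι ι ℝ} (hA : A.IsHermitian)
    (hnn : ∀ i j, 0 ≤ A i j) {c : ℝ} (hc : ∀ i, hA.eigenvalues i ≤ c) (i : ι) :
    |hA.eigenvalues i| ≤ c := by
  set v : ι → ℝ := ⇑(hA.eigenvectorBasis i) with hv
  have hvv : v ⬝ᵥ v = 1 := by
    have h := hA.eigenvectorBasis.orthonormal.1 i
    have h2 := EuclideanSpace.real_norm_sq_eq (hA.eigenvectorBasis i)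
    rw [h] at h2
    simp only [dotProduct, ← pow_two, hv]
    linarith
  have hAv : v ⬝ᵥ (A *ᵥ v) = hA.eigenvalues i := by
    rw [hv, hA.mulVec_eigenvectorBasis, dotProduct_smul, ← hv, hvv]
    simp
  have habs : (fun j => |v j|) ⬝ᵥ (fun j => |v j|) = 1 := by
    rw [← hvv]
    simp [dotProduct]
  -- As `A` has nonnegative entries, passing from `v` to `|v|` can only increase the absolute value
  -- of the quadratic form.
  have h := hA.dotProduct_mulVec_le hc fun j => |v j|
  rw [habs, mul_one] at h
  refine le_trans ?_ h
  rw [← hAv]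
  simp only [dotProduct, mulVec]
  refine (Finset.abs_sum_le_sum_abs _ _).trans (Finset.sum_le_sum fun j _ => ?_)
  rw [abs_mul]
  refine mul_le_mul_of_nonneg_left ?_ (abs_nonneg _)
  refine (Finset.abs_sum_le_sum_abs _ _).trans (Finset.sum_le_sum fun k _ => ?_)
  rw [abs_mul, abs_of_nonneg (hnn j k)]

/-- A matrix of rank at most `Fintype.card κ` is determined by the rows and columns through a
nonsingular principal submatrix indexed by `κ`. -/
theorem eq_mul_mul_of_rank_le {κ : Type*} [Fintype κ] [DecidableEq κ] {A : Matrix ι ι ℝ}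
    (hA : A.rank ≤ Fintype.card κ) (f : κ → ι) {B : Matrix κ κ ℝ}
    (hB : A.submatrix f f * B = 1) : A = A.submatrix id f * B * A.submatrix f id := by
  have hsub : ∀ C : Matrix κ ι ℝ, A.submatrix f id * ((1 : Matrix ι ι ℝ).submatrix id f * C) =
      A.submatrix f f * C := by
    intro C
    rw [← Matrix.mul_assoc]
    congr 1
    ext i j
    simp [Matrix.mul_apply, Matrix.one_apply]
  have hsub' : ∀ C : Matrix κ ι ℝ, A * ((1 : Matrix ι ι ℝ).submatrix id f * C) =
      A.submatrix id f * C := by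
    intro C
    rw [← Matrix.mul_assoc]
    congr 1
    ext i j
    simp [Matrix.mul_apply, Matrix.one_apply]
  set D := A.submatrix f id with hD
  have hrank : Fintype.card κ ≤ D.rank := by
    have h1 : A.submatrix f f = D * (1 : Matrix ι ι ℝ).submatrix id f := by
      ext i j
      simp [hD, Matrix.mul_apply, Matrix.one_apply]
    calc Fintype.card κ = (1 : Matrix κ κ ℝ).rank := rank_one.symm
      _ ≤ (A.submatrix f f).rank := by rw [← hB]; exact rank_mul_le_left _ _
      _ ≤ D.rank := by rw [h1]; exact rank_mul_le_left _ _
  have hker : LinearMap.ker A.mulVecLin = LinearMap.ker D.mulVecLin := by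
    refine Submodule.eq_of_le_of_finrank_le (fun v hv => ?_) ?_
    · rw [LinearMap.mem_ker, mulVecLin_apply] at hv ⊢
      ext i
      exact congrFun hv (f i)
    · have h1 := A.mulVecLin.finrank_range_add_finrank_ker
      have h2 := D.mulVecLin.finrank_range_add_finrank_ker
      rw [← Matrix.rank] at h1 h2
      omega
  -- The columns of `E` lie in `ker D = ker A`; expanding `A * E = 0` is the claimed factorization.
  set E : Matrix ι ι ℝ := 1 - (1 : Matrix ι ι ℝ).submatrix id f * (B * D) with hE
  have hDE : D * E = 0 := by
    rw [hE, Matrix.mul_sub, hsub, ← Matrix.mul_assoc, hB]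
    simp
  have hAE : A * E = 0 := by
    ext i j
    have hj : E.col j ∈ LinearMap.ker D.mulVecLin := by
      rw [LinearMap.mem_ker, mulVecLin_apply]
      ext k
      exact congrFun (congrFun hDE k) j
    rw [← hker, LinearMap.mem_ker, mulVecLin_apply] at hj
    exact congrFun hj i
  rw [hE, Matrix.mul_sub, hsub', Matrix.mul_one, sub_eq_zero, ← Matrix.mul_assoc] at hAE
  exact hAE

end Matrix

/-! ### Equality in the eigenvalue bound as a rank condition -/

namespace SimpleGraph

variable {V : Type*} [Fintype V] [DecidableEq V] (G : SimpleGraph V) [DecidableRel G.Adj]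

theorem trace_adjMatrix_sq : (G.adjMatrix ℝ ^ 2).trace = 2 * (G.edgeFinset.card : ℝ) := by
  rw [pow_two, Matrix.trace]
  simp only [Matrix.diag_apply, adjMatrix_mul_self_apply_self]
  exact_mod_cast G.sum_degrees_eq_twice_card_edges

theorem CliqueFree.trace_adjMatrix_cube {G : SimpleGraph V} [DecidableRel G.Adj]
    (hG : G.CliqueFree 3) : (G.adjMatrix ℝ ^ 3).trace = 0 := by
  rw [pow_succ, pow_two, Matrix.trace]
  refine Finset.sum_eq_zero fun i _ => ?_
  rw [Matrix.diag_apply, Matrix.mul_apply]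
  refine Finset.sum_eq_zero fun j _ => ?_
  rw [Matrix.mul_apply, Finset.sum_mul]
  refine Finset.sum_eq_zero fun k _ => ?_
  simp only [adjMatrix_apply]
  by_cases h1 : G.Adj i k
  · by_cases h2 : G.Adj k j
    · by_cases h3 : G.Adj j i
      · exact absurd (is3Clique_triple_iff.2 ⟨h1, h3.symm, h2⟩) (hG {i, k, j})
      · simp [h3]
    · simp [h2]
  · simp [h1]

theorem sum_sq_adjEigenvalues (hn : 3 ≤ Fintype.card V) (h₀ : 0 < Fintype.card V)
    (h₁ : 1 < Fintype.card V) (hG : G.CliqueFree 3) :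
    G.adjEigenvalues ⟨0, h₀⟩ ^ 2 + G.adjEigenvalues ⟨1, h₁⟩ ^ 2 ≤
        (G.edgeFinset.card : ℝ) ∧
      (G.adjEigenvalues ⟨0, h₀⟩ ^ 2 + G.adjEigenvalues ⟨1, h₁⟩ ^ 2 =
          (G.edgeFinset.card : ℝ) ↔ (G.adjMatrix ℝ).rank ≤ 4) := by
  have hA := G.isHermitian_adjMatrix (R := ℝ)
  have hx : Antitone G.adjEigenvalues := hA.eigenvalues₀_antitone
  have h1 : ∑ i, G.adjEigenvalues i = 0 := by
    have := hA.trace_pow_eq_sum_eigenvalues₀ 1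
    rw [pow_one, trace_adjMatrix] at this
    simpa [adjEigenvalues] using this.symm
  have h2 : ∑ i, G.adjEigenvalues i ^ 2 = 2 * (G.edgeFinset.card : ℝ) :=
    (hA.trace_pow_eq_sum_eigenvalues₀ 2).symm.trans G.trace_adjMatrix_sq
  have h3 : ∑ i, G.adjEigenvalues i ^ 3 = 0 :=
    (hA.trace_pow_eq_sum_eigenvalues₀ 3).symm.trans hG.trace_adjMatrix_cube
  have hmax : ∀ i, |G.adjEigenvalues i| ≤ G.adjEigenvalues ⟨0, h₀⟩ := by
    intro i
    have := hA.abs_eigenvalues_le (fun i j => by rw [adjMatrix_apply]; split_ifs <;> simp)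
      (c := G.adjEigenvalues ⟨0, h₀⟩) (fun i => hx (Nat.zero_le _))
      (Fintype.equivOfCardEq (Fintype.card_fin _) i)
    simpa [Matrix.IsHermitian.eigenvalues, adjEigenvalues] using this
  have hr := hA.rank_eq_card_support_eigenvalues₀
  have hfwd := sum_sq_eq_and_card_support_le_four hn hx hmax h1 h2 h3
  refine ⟨?_, fun h => ?_, fun h => ?_⟩
  -- A strict violation also satisfies the hypothesis of `hfwd`, which then yields equality.
  · by_contra! h
    exact h.ne' (hfwd h.le).1
  · rw [hr]
    exact (hfwd h.ge).2
  · exact sum_sq_eq_of_card_support_le_four hn hx h1 h2 h3 (hr ▸ h)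

end SimpleGraph

/-! ### Blow-ups -/

namespace SimpleGraph

section BlowUp

variable {V : Type u} {W : Type*} {G : SimpleGraph V} {H : SimpleGraph W}

/-- The parts are the fibres of `t`, which need not be surjective since parts may be empty. -/
theorem isBlowUpOf_iff : G.IsBlowUpOf H ↔ ∃ t : V → W, ∀ v w, G.Adj v w ↔ H.Adj (t v) (t w) := by
  constructor
  · rintro ⟨I, ⟨e⟩⟩
    exact ⟨fun v => (e v).1, fun v w => e.map_adj_iff.symm⟩
  · rintro ⟨t, ht⟩
    exact ⟨fun x => {v // t v = x}, ⟨{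
      toEquiv := (Equiv.sigmaFiberEquiv t).symm
      map_rel_iff' := fun {v w} => (ht v w).symm }⟩⟩

theorem IsBlowUpOf.trans_map {W' : Type*} {H' : SimpleGraph W'} (h : G.IsBlowUpOf H) (e : W → W')
    (he : ∀ x y, H.Adj x y ↔ H'.Adj (e x) (e y)) : G.IsBlowUpOf H' := by
  obtain ⟨t, ht⟩ := isBlowUpOf_iff.1 h
  exact isBlowUpOf_iff.2 ⟨e ∘ t, fun v w => (ht v w).trans (he _ _)⟩

end BlowUp

theorem CliqueFree.not_adj_of_adj_of_adj {V : Type*} {G : SimpleGraph V} (hG : G.CliqueFree 3) {x y z : V} (h1 : G.Adj x y)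
    (h2 : G.Adj x z) : ¬ G.Adj y z := fun h3 => by
  classical exact hG _ (is3Clique_triple_iff.2 ⟨h1, h2, h3⟩)

variable {V : Type u} [Fintype V] {G : SimpleGraph V} [DecidableRel G.Adj]

theorem IsBlowUpOf.rank_adjMatrix_le_four
    (h : G.IsBlowUpOf (pathGraph 5 ⊕g (⊤ : SimpleGraph (Fin 1)))) :
    (G.adjMatrix ℝ).rank ≤ 4 := by
  classical
  obtain ⟨t, ht⟩ := isBlowUpOf_iff.1 h
  -- `Q` lists the adjacency rows of path vertices 0, 1, 3, 4, and `P` expresses every row in them;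
  -- row 2 is row 0 plus row 4.
  let P : Fin 5 ⊕ Fin 1 → Fin 4 → ℝ :=
    Sum.elim ![![1, 0, 0, 0], ![0, 1, 0, 0], ![1, 0, 0, 1], ![0, 0, 1, 0], ![0, 0, 0, 1]] 0
  let Q : Fin 5 ⊕ Fin 1 → Fin 4 → ℝ :=
    Sum.elim ![![0, 1, 0, 0], ![1, 0, 0, 0], ![0, 1, 1, 0], ![0, 0, 0, 1], ![0, 0, 1, 0]] 0
  have hPQ : ∀ x y, (if (pathGraph 5 ⊕g (⊤ : SimpleGraph (Fin 1))).Adj x y then (1 : ℝ) else 0) =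
      ∑ k, P x k * Q y k := by
    rintro (x | x) (y | y)
    · fin_cases x <;> fin_cases y <;> simp [P, Q, pathGraph_adj, Fin.sum_univ_four]
    · simp [Q]
    · simp [P]
    · simp [P, Subsingleton.elim x y]
  have hA : G.adjMatrix ℝ =
      Matrix.of (fun v k => P (t v) k) * Matrix.of (fun k w => Q (t w) k) := by
    ext v w
    rw [adjMatrix_apply, Matrix.mul_apply]
    simp only [ht, Matrix.of_apply]
    exact hPQ _ _
  rw [hA]
  exact (Matrix.rank_mul_le_left _ _).trans ((Matrix.rank_le_card_width _).trans (by simp))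

/-! ### Triangle-free graphs of rank at most four -/

section Structure

variable [DecidableEq V] {a b c d : V}

/-- Adjacency to `a, b, c, d` determines every entry; `B` is the inverse of the adjacency matrix of
`2P₂`, which is an involution. -/
theorem adjMatrix_apply_of_induced_two_edges (hr : (G.adjMatrix ℝ).rank ≤ 4)
    (hab : G.Adj a b) (hcd : G.Adj c d) (hac : ¬ G.Adj a c) (had : ¬ G.Adj a d)
    (hbc : ¬ G.Adj b c) (hbd : ¬ G.Adj b d) (v w : V) :
    G.adjMatrix ℝ v w = G.adjMatrix ℝ v a * G.adjMatrix ℝ w b +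
      G.adjMatrix ℝ v b * G.adjMatrix ℝ w a + G.adjMatrix ℝ v c * G.adjMatrix ℝ w d +
      G.adjMatrix ℝ v d * G.adjMatrix ℝ w c := by
  have h := Matrix.eq_mul_mul_of_rank_le (κ := Fin 4) (by simpa using hr) ![a, b, c, d]
    (B := !![0, 1, 0, 0; 1, 0, 0, 0; 0, 0, 0, 1; 0, 0, 1, 0]) (by
      ext i j
      simp only [Matrix.mul_apply, Fin.sum_univ_four, Matrix.submatrix_apply]
      fin_cases i <;> fin_cases j <;>
        simp [hab, hcd, hac, had, hbc, hbd, hab.symm,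
          hcd.symm, G.adj_comm c a, G.adj_comm d a, G.adj_comm c b, G.adj_comm d b])
  have h' := congrFun (congrFun h v) w
  simp only [Matrix.mul_apply, Fin.sum_univ_four, Matrix.submatrix_apply, id] at h'
  have hs := fun x : V => (G.isSymm_adjMatrix (α := ℝ)).apply x w
  rw [h', hs a, hs b, hs c, hs d]
  simp [-adjMatrix_apply]
  ring

theorem adjMatrix_apply_of_induced_path (hr : (G.adjMatrix ℝ).rank ≤ 4)
    (hab : G.Adj a b) (hbc : G.Adj b c) (hcd : G.Adj c d) (hac : ¬ G.Adj a c)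
    (had : ¬ G.Adj a d) (hbd : ¬ G.Adj b d) (v w : V) :
    G.adjMatrix ℝ v w = G.adjMatrix ℝ v a * G.adjMatrix ℝ w b +
      G.adjMatrix ℝ v b * G.adjMatrix ℝ w a + G.adjMatrix ℝ v c * G.adjMatrix ℝ w d +
      G.adjMatrix ℝ v d * G.adjMatrix ℝ w c - G.adjMatrix ℝ v a * G.adjMatrix ℝ w d -
      G.adjMatrix ℝ v d * G.adjMatrix ℝ w a := by
  have h := Matrix.eq_mul_mul_of_rank_le (κ := Fin 4) (by simpa using hr) ![a, b, c, d]
    (B := !![0, 1, 0, -1; 1, 0, 0, 0; 0, 0, 0, 1; -1, 0, 1, 0]) (by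
      ext i j
      simp only [Matrix.mul_apply, Fin.sum_univ_four, Matrix.submatrix_apply]
      fin_cases i <;> fin_cases j <;>
        simp [hab, hcd, hac, had, hbc, hbd, hab.symm,
          hcd.symm, hbc.symm, G.adj_comm c a, G.adj_comm d a, G.adj_comm d b])
  have h' := congrFun (congrFun h v) w
  simp only [Matrix.mul_apply, Fin.sum_univ_four, Matrix.submatrix_apply, id] at h'
  have hs := fun x : V => (G.isSymm_adjMatrix (α := ℝ)).apply x w
  rw [h', hs a, hs b, hs c, hs d]
  simp [-adjMatrix_apply]
  ring

/-- The vertices `b, a, z, c, d` form an induced path, and every vertex is a twin of one of these or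
isolated. -/
theorem isBlowUpOf_path_five_of_adj (hG : G.CliqueFree 3) (hr : (G.adjMatrix ℝ).rank ≤ 4)
    (hab : G.Adj a b) (hcd : G.Adj c d) (hac : ¬ G.Adj a c) (had : ¬ G.Adj a d)
    (hbc : ¬ G.Adj b c) (hbd : ¬ G.Adj b d) {z : V} (hza : G.Adj z a) (hzc : G.Adj z c) :
    G.IsBlowUpOf (pathGraph 5 ⊕g (⊤ : SimpleGraph (Fin 1))) := by
  have key := adjMatrix_apply_of_induced_two_edges hr hab hcd hac had hbc hbd
  have hzb := hG.not_adj_of_adj_of_adj hab hza.symm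
  have hzd := hG.not_adj_of_adj_of_adj hcd hzc.symm
  rw [G.adj_comm] at hzb hzd
  have htype : ∀ v, ¬ (G.Adj v a ∧ G.Adj v b) ∧ ¬ (G.Adj v c ∧ G.Adj v d) ∧
      ¬ (G.Adj v a ∧ G.Adj v d) ∧ ¬ (G.Adj v b ∧ G.Adj v c) ∧ ¬ (G.Adj v b ∧ G.Adj v d) := by
    intro v
    -- This reads `A v z = A v b + A v d`: a neighbour of `b` or `d` is adjacent to `z`, hence to
    -- neither `a` nor `c`, and not to both `b` and `d`.
    have h := key v z
    have t1 := fun h1 h2 => hG.not_adj_of_adj_of_adj (x := v) (y := a) (z := b) h1 h2 hab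
    have t2 := fun h1 h2 => hG.not_adj_of_adj_of_adj (x := v) (y := c) (z := d) h1 h2 hcd
    have t3 := fun h1 h2 => hG.not_adj_of_adj_of_adj (x := v) (y := a) (z := z) h1 h2 hza.symm
    have t4 := fun h1 h2 => hG.not_adj_of_adj_of_adj (x := v) (y := c) (z := z) h1 h2 hzc.symm
    simp only [adjMatrix_apply, hza, hzb, hzc, hzd] at h
    clear key
    by_cases va : G.Adj v a <;> by_cases vb : G.Adj v b <;> by_cases vc : G.Adj v c <;>
      by_cases vd : G.Adj v d <;> by_cases vz : G.Adj v z <;> simp_all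
    norm_num at h
  refine isBlowUpOf_iff.2 ⟨fun v => if G.Adj v a then (if G.Adj v c then .inl 2 else .inl 0)
    else if G.Adj v c then .inl 4 else if G.Adj v b then .inl 1 else if G.Adj v d then .inl 3
    else .inr 0, fun v w => ?_⟩
  have h := key v w
  have hv := htype v
  have hw := htype w
  simp only [adjMatrix_apply] at h
  by_cases va : G.Adj v a <;> by_cases vb : G.Adj v b <;> by_cases vc : G.Adj v c <;>
    by_cases vd : G.Adj v d <;>
    simp only [va, vb, vc, vd, and_self, and_true, and_false, not_true, not_false_eq_true,
      if_true, if_false, one_mul, zero_mul, add_zero, zero_add] at hv h ⊢ <;>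
    by_cases wa : G.Adj w a <;> by_cases wb : G.Adj w b <;> by_cases wc : G.Adj w c <;>
    by_cases wd : G.Adj w d <;>
    simp only [wa, wb, wc, wd, and_self, and_true, and_false, not_true, not_false_eq_true,
      if_true, if_false] at hw h ⊢ <;>
    by_cases vw : G.Adj v w <;>
    simp [vw, pathGraph_adj] at h ⊢

theorem isBlowUpOf_two_edges (hG : G.CliqueFree 3) (hr : (G.adjMatrix ℝ).rank ≤ 4)
    (hab : G.Adj a b) (hcd : G.Adj c d) (hac : ¬ G.Adj a c) (had : ¬ G.Adj a d)
    (hbc : ¬ G.Adj b c) (hbd : ¬ G.Adj b d)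
    (hz : ∀ z, G.Adj z a ∨ G.Adj z b → ¬ (G.Adj z c ∨ G.Adj z d)) :
    G.IsBlowUpOf (pathGraph 2 ⊕g pathGraph 2 ⊕g (⊤ : SimpleGraph (Fin 1))) := by
  have key := adjMatrix_apply_of_induced_two_edges hr hab hcd hac had hbc hbd
  refine isBlowUpOf_iff.2 ⟨fun v => if G.Adj v a then .inl (.inl 1) else if G.Adj v b then
    .inl (.inl 0) else if G.Adj v c then .inl (.inr 1) else if G.Adj v d then .inl (.inr 0)
    else .inr 0, fun v w => ?_⟩
  have h := key v w
  have htype : ∀ v, (¬ (G.Adj v a ∧ G.Adj v b) ∧ ¬ (G.Adj v c ∧ G.Adj v d)) ∧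
      ¬ ((G.Adj v a ∨ G.Adj v b) ∧ (G.Adj v c ∨ G.Adj v d)) := fun v =>
    ⟨⟨fun h => hG.not_adj_of_adj_of_adj h.1 h.2 hab,
      fun h => hG.not_adj_of_adj_of_adj h.1 h.2 hcd⟩, fun h => hz v h.1 h.2⟩
  have hv := htype v
  have hw := htype w
  clear key hz htype
  simp only [adjMatrix_apply] at h
  by_cases va : G.Adj v a <;> by_cases vb : G.Adj v b <;> by_cases vc : G.Adj v c <;>
    by_cases vd : G.Adj v d <;> simp [va, vb, vc, vd] at hv h ⊢ <;>
    by_cases wa : G.Adj w a <;> by_cases wb : G.Adj w b <;> by_cases wc : G.Adj w c <;>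
    by_cases wd : G.Adj w d <;> simp [wa, wb, wc, wd] at hw h ⊢ <;>
    by_cases vw : G.Adj v w <;> simp [vw, pathGraph_adj] at h ⊢

theorem isBlowUpOf_path_four (hG : G.CliqueFree 3) (hr : (G.adjMatrix ℝ).rank ≤ 4)
    (h2 : ∀ x y z w, G.Adj x y → G.Adj z w → G.Adj x z ∨ G.Adj x w ∨ G.Adj y z ∨ G.Adj y w)
    (hab : G.Adj a b) (hbc : G.Adj b c) (hcd : G.Adj c d) (hac : ¬ G.Adj a c)
    (had : ¬ G.Adj a d) (hbd : ¬ G.Adj b d) :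
    G.IsBlowUpOf (pathGraph 4 ⊕g (⊤ : SimpleGraph (Fin 1))) := by
  have key := adjMatrix_apply_of_induced_path hr hab hbc hcd hac had hbd
  have htype : ∀ v, (¬ (G.Adj v a ∧ G.Adj v b) ∧ ¬ (G.Adj v b ∧ G.Adj v c) ∧
      ¬ (G.Adj v c ∧ G.Adj v d)) ∧ (G.Adj v a → G.Adj v c) ∧ (G.Adj v d → G.Adj v b) := by
    intro v
    have t1 : ¬ (G.Adj v a ∧ G.Adj v b) := fun h => hG.not_adj_of_adj_of_adj h.1 h.2 hab
    have t2 : ¬ (G.Adj v b ∧ G.Adj v c) := fun h => hG.not_adj_of_adj_of_adj h.1 h.2 hbc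
    have t3 : ¬ (G.Adj v c ∧ G.Adj v d) := fun h => hG.not_adj_of_adj_of_adj h.1 h.2 hcd
    have t4 : ¬ (G.Adj v a ∧ G.Adj v d) := by
      rintro ⟨va, vd⟩
      have vb : ¬ G.Adj v b := fun h => t1 ⟨va, h⟩
      have vc : ¬ G.Adj v c := fun h => t3 ⟨h, vd⟩
      -- A vertex closing the path to a 5-cycle would have diagonal entry `-2`.
      have h := key v v
      simp only [adjMatrix_apply, va, vb, vc, vd, G.irrefl] at h
      norm_num at h
    refine ⟨⟨t1, t2, t3⟩, fun va => ?_, fun vd => ?_⟩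
    · have := h2 v a c d va hcd
      tauto
    · have := h2 v d a b vd hab
      rw [G.adj_comm d a, G.adj_comm d b] at this
      tauto
  refine isBlowUpOf_iff.2 ⟨fun v => if G.Adj v b then (if G.Adj v d then .inl 2 else .inl 0)
    else if G.Adj v c then (if G.Adj v a then .inl 1 else .inl 3) else .inr 0, fun v w => ?_⟩
  have h := key v w
  have hv := htype v
  have hw := htype w
  clear key h2 htype
  simp only [adjMatrix_apply] at h
  by_cases va : G.Adj v a <;> by_cases vb : G.Adj v b <;> by_cases vc : G.Adj v c <;>
    by_cases vd : G.Adj v d <;> simp [va, vb, vc, vd] at hv h ⊢ <;>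
    by_cases wa : G.Adj w a <;> by_cases wb : G.Adj w b <;> by_cases wc : G.Adj w c <;>
    by_cases wd : G.Adj w d <;> simp [wa, wb, wc, wd] at hw h ⊢ <;>
    by_cases vw : G.Adj v w <;> simp [vw, pathGraph_adj] at h ⊢

end Structure

/-- `h2` and `h4` exclude induced `2P₂` and `P₄`. Given an edge `ab`, the latter joins every
neighbour of `a` to every neighbour of `b`, and together they isolate all other vertices. -/
theorem CliqueFree.isBlowUpOf_path_two {V : Type u} {G : SimpleGraph V} (hG : G.CliqueFree 3)
    (h2 : ∀ x y z w, G.Adj x y → G.Adj z w → G.Adj x z ∨ G.Adj x w ∨ G.Adj y z ∨ G.Adj y w)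
    (h4 : ∀ x y z w, G.Adj x y → G.Adj y z → G.Adj z w → ¬ G.Adj x z → ¬ G.Adj y w → G.Adj x w) :
    G.IsBlowUpOf (pathGraph 2 ⊕g (⊤ : SimpleGraph (Fin 1))) := by
  classical
  rw [isBlowUpOf_iff]
  by_cases hex : ∃ a b, G.Adj a b
  · obtain ⟨a, b, hab⟩ := hex
    have hboth : ∀ v, G.Adj v b → ¬ G.Adj v a := fun v hb ha =>
      hG.not_adj_of_adj_of_adj ha hb hab
    have hjoin : ∀ v w, G.Adj v b → G.Adj w a → G.Adj v w := fun v w hv hw =>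
      h4 v b a w hv hab.symm hw.symm (hboth v hv) fun h => hboth w h.symm hw
    have hout : ∀ v w, ¬ G.Adj w a → ¬ G.Adj w b → ¬ G.Adj w v := by
      intro v w ha hb hwv
      by_cases hva : G.Adj v a
      · exact hb (h4 w v a b hwv hva hab ha fun h => hboth v h hva)
      · by_cases hvb : G.Adj v b
        · exact ha (h4 w v b a hwv hvb hab.symm hb hva)
        · have := h2 w v a b hwv hab
          tauto
    refine ⟨fun v => if G.Adj v b then .inl 0 else if G.Adj v a then .inl 1 else .inr 0,
      fun v w => ?_⟩
    by_cases vb : G.Adj v b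
    · by_cases wb : G.Adj w b
      · simpa [vb, wb] using hG.not_adj_of_adj_of_adj vb.symm wb.symm
      · by_cases wa : G.Adj w a
        · simpa [vb, wb, wa, pathGraph_adj] using hjoin v w vb wa
        · simpa [vb, wb, wa, G.adj_comm v w] using hout v w wa wb
    · by_cases va : G.Adj v a
      · by_cases wb : G.Adj w b
        · simpa [vb, wb, va, pathGraph_adj] using (hjoin w v wb va).symm
        · by_cases wa : G.Adj w a
          · simpa [vb, wb, va, wa] using hG.not_adj_of_adj_of_adj va.symm wa.symm
          · simpa [vb, wb, va, wa, G.adj_comm v w] using hout v w wa wb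
      · have h := hout w v va vb
        by_cases wb : G.Adj w b
        · simpa [vb, va, wb] using h
        · by_cases wa : G.Adj w a
          · simpa [vb, va, wb, wa] using h
          · simpa [vb, va, wb, wa] using h
  · push Not at hex
    exact ⟨fun _ => .inr 0, fun v w => by simpa using hex v w⟩

theorem CliqueFree.rank_adjMatrix_le_four_iff [DecidableEq V] (hG : G.CliqueFree 3) :
    (G.adjMatrix ℝ).rank ≤ 4 ↔
        G.IsBlowUpOf (pathGraph 2 ⊕g (⊤ : SimpleGraph (Fin 1))) ∨
        G.IsBlowUpOf (pathGraph 2 ⊕g pathGraph 2 ⊕g (⊤ : SimpleGraph (Fin 1))) ∨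
        G.IsBlowUpOf (pathGraph 4 ⊕g (⊤ : SimpleGraph (Fin 1))) ∨
        G.IsBlowUpOf (pathGraph 5 ⊕g (⊤ : SimpleGraph (Fin 1))) := by
  constructor
  · intro hr
    by_cases h2 : ∀ x y z w, G.Adj x y → G.Adj z w →
        G.Adj x z ∨ G.Adj x w ∨ G.Adj y z ∨ G.Adj y w
    · by_cases h4 : ∀ x y z w, G.Adj x y → G.Adj y z → G.Adj z w → ¬ G.Adj x z → ¬ G.Adj y w →
          G.Adj x w
      · exact .inl (hG.isBlowUpOf_path_two h2 h4)
      · push Not at h4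
        obtain ⟨a, b, c, d, hab, hbc, hcd, hac, hbd, had⟩ := h4
        exact .inr (.inr (.inl (isBlowUpOf_path_four hG hr h2 hab hbc hcd hac had hbd)))
    · push Not at h2
      obtain ⟨a, b, c, d, hab, hcd, hac, had, hbc, hbd⟩ := h2
      by_cases hz : ∀ z, G.Adj z a ∨ G.Adj z b → ¬ (G.Adj z c ∨ G.Adj z d)
      · exact .inr (.inl (isBlowUpOf_two_edges hG hr hab hcd hac had hbc hbd hz))
      · push Not at hz
        obtain ⟨z, hza | hzb, hzc | hzd⟩ := hz
        · exact .inr (.inr (.inr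
            (isBlowUpOf_path_five_of_adj hG hr hab hcd hac had hbc hbd hza hzc)))
        · exact .inr (.inr (.inr
            (isBlowUpOf_path_five_of_adj hG hr hab hcd.symm had hac hbd hbc hza hzd)))
        · exact .inr (.inr (.inr
            (isBlowUpOf_path_five_of_adj hG hr hab.symm hcd hbc hbd hac had hzb hzc)))
        · exact .inr (.inr (.inr
            (isBlowUpOf_path_five_of_adj hG hr hab.symm hcd.symm hbd hbc had hac hzb hzd)))
  · rintro (h | h | h | h)
    · refine (h.trans_map (Sum.elim (fun i => .inl (i.castLE (by simp))) .inr)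
        ?_).rank_adjMatrix_le_four
      rintro (x | x) (y | y) <;> simp [pathGraph_adj]
    -- The smaller graphs are induced subgraphs of `P₅ ∪ K₁`; here the shift by 3 skips the middle
    -- vertex of the path.
    · refine (h.trans_map (Sum.elim (Sum.elim (fun i => .inl (i.castLE (by simp)))
        (fun i => .inl (Fin.natAdd 3 i))) .inr) ?_).rank_adjMatrix_le_four
      rintro ((x | x) | x) ((y | y) | y) <;> simp [pathGraph_adj] <;> omega
    · refine (h.trans_map (Sum.elim (fun i => .inl (i.castLE (by simp))) .inr)
        ?_).rank_adjMatrix_le_four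
      rintro (x | x) (y | y) <;> simp [pathGraph_adj]
    · exact h.rank_adjMatrix_le_four

end SimpleGraph

theorem mainTheorem1 {V : Type u} [Fintype V] [DecidableEq V] (G : SimpleGraph V)
    [DecidableRel G.Adj] (hn : 3 ≤ Fintype.card V) (hG : G.CliqueFree 3) :
    G.adjEigenvalues ⟨0, by omega⟩ ^ 2 + G.adjEigenvalues ⟨1, by omega⟩ ^ 2 ≤
        (G.edgeFinset.card : ℝ) ∧
      (G.adjEigenvalues ⟨0, by omega⟩ ^ 2 + G.adjEigenvalues ⟨1, by omega⟩ ^ 2 =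
          (G.edgeFinset.card : ℝ) ↔
        G.IsBlowUpOf (SimpleGraph.pathGraph 2 ⊕g (⊤ : SimpleGraph (Fin 1))) ∨
        G.IsBlowUpOf (SimpleGraph.pathGraph 2 ⊕g SimpleGraph.pathGraph 2 ⊕g
          (⊤ : SimpleGraph (Fin 1))) ∨
        G.IsBlowUpOf (SimpleGraph.pathGraph 4 ⊕g (⊤ : SimpleGraph (Fin 1))) ∨
        G.IsBlowUpOf (SimpleGraph.pathGraph 5 ⊕g (⊤ : SimpleGraph (Fin 1)))) := by
  rw [← hG.rank_adjMatrix_le_four_iff]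
  exact G.sum_sq_adjEigenvalues hn _ _ hG
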